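/- For $n\ge 1$ let $A_n=\{0,\dots,n\}$ and let $\tau_n:A_n\to A_n^3$ be the substitution $\tau_n(a)=a\,0\,(a+1)$ for $a\ne n$, $\tau_n(n)=n\,0\,n$, extended by concatenation to words and to two-sided sequences. Let $X_n\subseteq A_n^{\mathbb Z}$ be the subshift generated by $\tau_n$ (the two-sided sequences all of whose finite subwords occur in words $\tau_n^k(a)$, $k\ge 0$, $a\in A_n$), with the shift $T_n$, and let $\rho_n:X_{n+1}\to X_n$ be the letter-to-letter map induced by $\rho_n(a)=a$ for $a\ne n+1$, $\rho_n(n+1)=n$. Let $$X=\Big\{(x_n)_{n\ge1}\in\prod_{n\ge1}X_n:\ \rho_n(x_{n+1})=x_n\ \text{ for all } n\ge1\Big\},\qquad T\big((x_n)_{n\ge 1}\big)=(T_n x_n)_{n\ge 1}.$$ For every $n\ge 1$ and $x\in X_n$ there is a unique sequence $(\delta_i)_{i\ge0}$ in $\{0,1,2\}$ for which there are points $x^{(0)}=x,\,x^{(1)},\,x^{(2)},\dots$ of $X_n$ with $\tau_n(x^{(i+1)})=T_n^{-\delta_i}x^{(i)}$ for all $i\ge0$; put $\pi_n(x)=\sum_{i\ge0}\delta_i3^i\in\mathcal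 O_3$, where the $3$-odometer $\mathcal O_3=\varprojlim \mathbb Z/3^k\mathbb Z$ (the $3$-adic integers) carries the map $z\mapsto z+1$. For $(x_n)\in X$ the value $\pi_n(x_n)$ does not depend on $n$, and $\pi:X\to\mathcal O_3$, $\pi((x_n)_{n\ge 1})=\pi_n(x_n)$, is a factor map: it is continuous and onto, and $\pi(Tx)=\pi(x)+1$. **Proposition.** The map $\pi:X\to\mathcal O_3$ is at most countable-to-one: $\pi^{-1}(\{z\})$ is finite or countable for every $z\in\mathcal O_3$. Hence every scrambled set of $(X,T)$ is finite or countable, where for a metric $\varrho$ on $X$ compatible with the product topology a set $S\subseteq X$ is called scrambled if $\limsup_{k\to\infty}\varrho(T^kx,T^ky)>0$ and $\liminf_{k\to\infty}\varrho(T^kx,T^ky)=0$ for all distinct $x,y\in S$. -/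

import Mathlib

open Filter Topology

namespace SubstInvLim

/-! ### Li-Yorke pairs and scrambled sets -/

/-- `{x, y}` is a Li-Yorke pair of `(X, T)` for the metric `m`: the distances of the `n`-th iterates
have positive limsup and zero liminf. The distance is read in `[0, ∞]`, so that both limits are
always meaningful. -/
def IsLiYorkePair {X : Type*} (m : MetricSpace X) (T : X → X) (x y : X) : Prop :=
  0 < limsup (fun n : ℕ => edist (T^[n] x) (T^[n] y)) atTop ∧
    liminf (fun n : ℕ => edist (T^[n] x) (T^[n] y)) atTop = 0

/-- A scrambled set: any two distinct points form a Li-Yorke pair. -/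
def IsScrambled {X : Type*} (m : MetricSpace X) (T : X → X) (S : Set X) : Prop :=
  S.Pairwise (IsLiYorkePair m T)

/-- The metric `m` is compatible with the topology `t`. -/
def IsCompatible {X : Type*} (m : MetricSpace X) (t : TopologicalSpace X) : Prop :=
  m.toPseudoMetricSpace.toUniformSpace.toTopologicalSpace = t

/-! ### Substitutions of constant length three -/

/-- The shift map `T` on two-sided sequences. -/
def shift {A : Type*} (x : ℤ → A) : ℤ → A := fun i => x (i + 1)

/-- Extension of a substitution `τ : A → A³` to words by concatenation. -/
def onWord {A : Type*} (τ : A → Fin 3 → A) (w : List A) : List A :=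
  w.flatMap fun a => List.ofFn (τ a)

/-- Extension of a substitution `τ : A → A³` to two-sided sequences,
`τ(x) = … τ(x₋₂) τ(x₋₁) . τ(x₀) τ(x₁) …`: the letter in position `3 q + r`, `0 ≤ r < 3`, is the
`r`-th letter of `τ(x_q)`. -/
def onSeq {A : Type*} (τ : A → Fin 3 → A) (x : ℤ → A) : ℤ → A :=
  fun i => τ (x (i / 3)) ⟨(i % 3).toNat, by omega⟩

/-- The word `x_i x_{i+1} … x_{i+l-1}`. -/
def subword {A : Type*} (x : ℤ → A) (i : ℤ) (l : ℕ) : List A :=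
  List.ofFn fun j : Fin l => x (i + (j : ℕ))

/-- The subshift `X_τ`: all two-sided sequences each of whose finite subwords occurs in some word
`τ^k(a)`. -/
def substShift {A : Type*} (τ : A → Fin 3 → A) : Set (ℤ → A) :=
  {x | ∀ (i : ℤ) (l : ℕ), ∃ (k : ℕ) (a : A), subword x i l <:+: (onWord τ)^[k] [a]}

theorem shift_mem_substShift {A : Type*} {τ : A → Fin 3 → A} {x : ℤ → A}
    (hx : x ∈ substShift τ) : shift x ∈ substShift τ := by
  intro i l
  obtain ⟨k, a, h⟩ := hx (i + 1) l
  refine ⟨k, a, ?_⟩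
  have e : subword (shift x) i l = subword x (i + 1) l := by
    unfold subword shift
    congr 1
    funext j
    congr 1
    ring
  rw [e]
  exact h

/-- `δ` is the sequence of base-three digits attached to the point `x` of `X_τ`: there are points
`x^{(0)} = x, x^{(1)}, x^{(2)}, …` of `X_τ` with `x^{(i)} = T^{δ_i} (τ (x^{(i+1)}))`, that is,
`τ (x^{(i+1)}) = T^{-δ_i} (x^{(i)})`. -/
def IsDigitSeq {A : Type*} (τ : A → Fin 3 → A) (x : ℤ → A) (δ : ℕ → Fin 3) : Prop :=
  ∃ y : ℕ → ℤ → A, y 0 = x ∧ (∀ i, y i ∈ substShift τ) ∧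
    ∀ i, y i = shift^[(δ i : ℕ)] (onSeq τ (y (i + 1)))

/-! ### The systems `X_n` and their inverse limit -/

/-- `τ_n(a) = a 0 (a+1)` if `a ≠ n`, and `τ_n(n) = n 0 n`, on the alphabet `{0, …, n}`. -/
def tau (n : ℕ) (a : Fin (n + 1)) : Fin 3 → Fin (n + 1) :=
  ![a, 0, if h : (a : ℕ) < n then ⟨a + 1, by omega⟩ else Fin.last n]

/-- `ρ_n : {0, …, n+1} → {0, …, n}` fixes the letters other than `n + 1` and sends `n + 1` to
`n`. -/
def rho (n : ℕ) (a : Fin (n + 1 + 1)) : Fin (n + 1) :=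
  if h : (a : ℕ) < n + 1 then ⟨a, h⟩ else Fin.last n

/-- The inverse limit `X` of the `X_n`, `n ≥ 1`, as a subspace of the product. The factors are
indexed by `k = n - 1`: the coordinate `x k` is the point `x_{k+1}` of `X_{k+1}`. -/
def invLimit : Set (∀ k : ℕ, ℤ → Fin (k + 1 + 1)) :=
  {x | (∀ k, x k ∈ substShift (tau (k + 1))) ∧
    ∀ k, (fun i => rho (k + 1) (x (k + 1) i)) = x k}

/-- The map `T` on the inverse limit: the shift in every coordinate. -/
def invShift (x : invLimit) : invLimit :=
  ⟨fun k => shift (x.1 k), fun k => shift_mem_substShift (x.2.1 k), fun k => by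
    funext i
    exact congrFun (x.2.2 k) (i + 1)⟩

end SubstInvLim

namespace SubstInvLim

/-! ### Words and two-sided sequences -/

/-! In a block `τ_n(a)` the middle letter is always `0` and the last never is, so three letters of a
point show how it is cut into blocks (`firstDigit`); the first letter of a block is `a`, so the
desubstituted point can be read off too (`desubst`). Hence the digits exist, are unique, depend
continuously on the point and are unchanged by `ρ_n`; the shift adds `1` with carry. A point is the
bottom of a tower of desubstitutions, and the tower is determined by its digits and its letters at
`-1`, `0`, `1` on all levels (`IsTower.eq_of_eq_near_zero`). If the digits are eventually neither
all `0` nor all `2`, that is, if `z` is not an integer, these letters are forced and the fibre has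
at most one point (`subsingleton_fiber`). Fibres over integers are shifts of the fibre over `0`.
There all digits are `0`, and a point is determined by its letters at the origin. These form a point
of the inverse limit of the alphabets, which is `ℕ ∪ {∞}`, hence countable (`countable_fiber_zero`).
Translation by `1` is an isometry of the odometer, so points with `liminf` zero have the same image:
a scrambled set lies in one fibre. -/

theorem shift_iterate_apply {A : Type*} (x : ℤ → A) (n : ℕ) (i : ℤ) :
    shift^[n] x i = x (i + n) := by
  induction n generalizing x with
  | zero => simp
  | succ n ih =>
    rw [Function.iterate_succ_apply, ih]
    simp only [shift]
    congr 1
    push_cast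
    ring

theorem getElem?_onWord {A : Type*} (τ : A → Fin 3 → A) (v : List A) (q : ℕ) (r : Fin 3) :
    (onWord τ v)[3 * q + r]? = v[q]?.map fun a => τ a r := by
  induction v generalizing q with
  | nil => simp [onWord]
  | cons a v ih =>
    have e : onWord τ (a :: v) = List.ofFn (τ a) ++ onWord τ v := by simp [onWord]
    rw [e]
    cases q with
    | zero =>
      rw [List.getElem?_append_left (by simp)]
      fin_cases r <;> rfl
    | succ q =>
      rw [List.getElem?_append_right (by simp; omega)]
      rw [List.getElem?_cons_succ, ← ih q]
      congr 1
      simp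
      omega

theorem onSeq_apply {A : Type*} (τ : A → Fin 3 → A) (x : ℤ → A) (q : ℤ) (r : Fin 3) :
    onSeq τ x (3 * q + r) = τ (x q) r := by
  have h1 : (3 * q + (r : ℤ)) / 3 = q := by omega
  have h2 : ((3 * q + (r : ℤ)) % 3).toNat = r := by omega
  simp only [onSeq, h1, h2]

theorem exists_eq_three_mul_add (i : ℤ) : ∃ (q : ℤ) (r : Fin 3), i = 3 * q + r :=
  ⟨i / 3, ⟨(i % 3).toNat, by omega⟩, by simp only; omega⟩

/-- The word `w`, with position `P` placed at the origin, agrees with `x` on `[-l, l]`. -/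
def MatchesAt {A : Type*} (x : ℤ → A) (l : ℕ) (w : List A) (P : ℤ) : Prop :=
  ∀ j : ℤ, |j| ≤ l → 0 ≤ P + j ∧ w[(P + j).toNat]? = some (x j)

theorem MatchesAt.mono {A : Type*} {x : ℤ → A} {l l' : ℕ} {w : List A} {P : ℤ}
    (h : MatchesAt x l w P) (hl : l' ≤ l) : MatchesAt x l' w P :=
  fun j hj => h j (hj.trans (by exact_mod_cast hl))

/-- Windows centred at the origin suffice, as they contain all others; keeping the position `P`
allows reducing it modulo 3. -/
theorem mem_substShift_iff {A : Type*} {τ : A → Fin 3 → A} {x : ℤ → A} :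
    x ∈ substShift τ ↔
      ∀ l : ℕ, ∃ (k : ℕ) (a : A) (P : ℤ), MatchesAt x l ((onWord τ)^[k] [a]) P := by
  constructor
  · intro h l
    obtain ⟨k, a, hka⟩ := h (-l) (2 * l + 1)
    rw [List.infix_iff_getElem?] at hka
    obtain ⟨p, -, hp⟩ := hka
    refine ⟨k, a, p + l, fun j hj => ?_⟩
    rw [abs_le] at hj
    refine ⟨by omega, ?_⟩
    have := hp (j + l).toNat (by simp [subword]; omega)
    rw [show ((p : ℤ) + l + j).toNat = (j + l).toNat + p by omega, this]
    simp only [subword, List.getElem_ofFn]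
    congr 2
    omega
  · intro h i l
    obtain ⟨k, a, P, hP⟩ := h (i.natAbs + l)
    refine ⟨k, a, ?_⟩
    rcases Nat.eq_zero_or_pos l with rfl | hl
    · exact ⟨[], _, by simp [subword]; rfl⟩
    · rw [List.infix_iff_getElem?]
      have h0 := hP i (by rw [abs_le]; omega)
      have key : ∀ j < l, ((onWord τ)^[k] [a])[j + (P + i).toNat]? = some (x (i + j)) := by
        intro j hj
        have := hP (i + j) (by rw [abs_le]; omega)
        rw [← this.2]
        congr 1
        omega
      refine ⟨(P + i).toNat, ?_, fun j hj => ?_⟩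
      · obtain ⟨hlt, -⟩ := List.getElem?_eq_some_iff.1 (key (l - 1) (by omega))
        simp [subword]
        omega
      · rw [key j (by simpa [subword] using hj)]
        simp [subword]

theorem comp_mem_substShift {A B : Type*} {τ : A → Fin 3 → A} {σ : B → Fin 3 → B} {f : A → B}
    (hf : ∀ a r, f (τ a r) = σ (f a) r) {x : ℤ → A} (hx : x ∈ substShift τ) :
    (fun i => f (x i)) ∈ substShift σ := by
  have hw : ∀ w, (onWord τ w).map f = onWord σ (w.map f) := by
    intro w
    simp only [onWord, List.map_flatMap, List.flatMap_map, List.map_ofFn]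
    congr 1
    funext a
    congr 1
    funext r
    exact hf a r
  have hk : ∀ k a, ((onWord τ)^[k] [a]).map f = (onWord σ)^[k] [f a] := by
    intro k a
    induction k with
    | zero => rfl
    | succ k ih => rw [Function.iterate_succ_apply', Function.iterate_succ_apply', hw, ih]
  intro i l
  obtain ⟨k, a, h⟩ := hx i l
  refine ⟨k, f a, ?_⟩
  rw [← hk]
  have := h.map f
  rw [subword, List.map_ofFn] at this
  exact this

theorem onSeq_comp {A B : Type*} {τ : A → Fin 3 → A} {σ : B → Fin 3 → B} {f : A → B}
    (hf : ∀ a r, f (τ a r) = σ (f a) r) (x : ℤ → A) :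
    onSeq σ (fun i => f (x i)) = fun i => f (onSeq τ x i) := by
  funext i
  simp [onSeq, hf]

theorem IsDigitSeq.comp {A B : Type*} {τ : A → Fin 3 → A} {σ : B → Fin 3 → B} {f : A → B}
    (hf : ∀ a r, f (τ a r) = σ (f a) r) {x : ℤ → A} {δ : ℕ → Fin 3} (h : IsDigitSeq τ x δ) :
    IsDigitSeq σ (fun i => f (x i)) δ := by
  obtain ⟨y, h0, hy, hs⟩ := h
  refine ⟨fun k i => f (y k i), by simp [h0], fun i => comp_mem_substShift hf (hy i), fun i => ?_⟩
  funext j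
  simp only [onSeq_comp hf, shift_iterate_apply]
  rw [hs, shift_iterate_apply]

theorem unshift_mem_substShift {A : Type*} {τ : A → Fin 3 → A} {x : ℤ → A}
    (hx : x ∈ substShift τ) : (fun i => x (i - 1)) ∈ substShift τ := by
  intro i l
  obtain ⟨k, a, h⟩ := hx (i - 1) l
  refine ⟨k, a, ?_⟩
  have e : subword (fun i => x (i - 1)) i l = subword x (i - 1) l := by
    unfold subword
    congr 1
    funext j
    exact congrArg x (by ring)
  rwa [e]

theorem isClosed_substShift {A : Type*} [TopologicalSpace A] [DiscreteTopology A]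
    (τ : A → Fin 3 → A) : IsClosed (substShift τ) := by
  have : substShift τ = ⋂ (i : ℤ) (l : ℕ), (fun (x : ℤ → A) (j : Fin l) => x (i + (j : ℕ))) ⁻¹'
      {u | ∃ (k : ℕ) (a : A), List.ofFn u <:+: (onWord τ)^[k] [a]} := by
    ext x
    simp [substShift, subword]
  rw [this]
  refine isClosed_iInter fun i => isClosed_iInter fun l => (isClosed_discrete _).preimage ?_
  fun_prop

/-! ### Desubstitution in `X_n` -/

@[simp] theorem tau_zero (n : ℕ) (a : Fin (n + 1)) : tau n a 0 = a := rfl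

@[simp] theorem tau_one (n : ℕ) (a : Fin (n + 1)) : tau n a 1 = 0 := rfl

theorem val_tau_two (n : ℕ) (a : Fin (n + 1)) : (tau n a 2 : ℕ) = min ((a : ℕ) + 1) n := by
  have := a.isLt
  simp only [tau]
  by_cases h : (a : ℕ) < n
  · simp [h]
  · simp [h]
    omega

theorem tau_two_ne_zero {n : ℕ} (hn : 1 ≤ n) (a : Fin (n + 1)) : tau n a 2 ≠ 0 := by
  intro h
  have := val_tau_two n a
  rw [h] at this
  simp at this
  omega

theorem val_rho (n : ℕ) (a : Fin (n + 1 + 1)) : (rho n a : ℕ) = min (a : ℕ) n := by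
  have := a.isLt
  unfold rho
  split_ifs with h
  · simp; omega
  · simp; omega

theorem rho_tau (n : ℕ) (a : Fin (n + 1 + 1)) (r : Fin 3) :
    rho n (tau (n + 1) a r) = tau n (rho n a) r := by
  apply Fin.ext
  fin_cases r
  · rfl
  · simp [val_rho]
  · simp only [Fin.reduceFinMk, val_rho, val_tau_two]
    omega

/-- The first digit of a point of `X_n`, read off from three letters. -/
def firstDigit {n : ℕ} (x : ℤ → Fin (n + 1)) : Fin 3 :=
  if x 1 = 0 ∧ x 2 ≠ 0 then 0 else if x 0 = 0 ∧ x 1 ≠ 0 then 1 else 2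

/-- The point `y` with `T^{-δ} x = τ(y)`, where `δ` is the first digit of `x`. -/
def desubst {n : ℕ} (x : ℤ → Fin (n + 1)) : ℤ → Fin (n + 1) :=
  fun q => x (3 * q - (firstDigit x : ℕ))

/-- The sequence of digits of a point of `X_n`. -/
def digits {n : ℕ} (x : ℤ → Fin (n + 1)) (i : ℕ) : Fin 3 := firstDigit (desubst^[i] x)

theorem shift_onSeq_apply {A : Type*} (τ : A → Fin 3 → A) (y : ℤ → A) (d : ℕ) (i q : ℤ) (r : Fin 3)
    (h : i + d = 3 * q + r) : shift^[d] (onSeq τ y) i = τ (y q) r := by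
  rw [shift_iterate_apply, h, onSeq_apply]

/-- Recognizability: a `0` followed by a nonzero letter at the right place betrays the middle and
the end of a block. -/
theorem firstDigit_shift_onSeq {n : ℕ} (hn : 1 ≤ n) (y : ℤ → Fin (n + 1)) (d : Fin 3) :
    firstDigit (shift^[(d : ℕ)] (onSeq (tau n) y)) = d := by
  set x := shift^[(d : ℕ)] (onSeq (tau n) y) with hx
  have key := shift_onSeq_apply (tau n) y d
  rw [← hx] at key
  clear_value x
  have h2 := tau_two_ne_zero hn
  unfold firstDigit
  fin_cases d
  · have e1 := key 1 0 1 (by simp)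
    have e2 := key 2 0 2 (by simp)
    simp [e1, e2, h2]
  · have e1 := key 0 0 1 (by simp)
    have e2 := key 1 0 2 (by simp)
    simp [e1, e2, h2]
  · have e1 := key 2 1 1 (by simp)
    have e2 := key 0 0 2 (by simp)
    simp [e1, e2, h2]

theorem desubst_shift_onSeq {n : ℕ} (hn : 1 ≤ n) (y : ℤ → Fin (n + 1)) (d : Fin 3) :
    desubst (shift^[(d : ℕ)] (onSeq (tau n) y)) = y := by
  funext q
  rw [desubst, firstDigit_shift_onSeq hn, shift_onSeq_apply (q := q) (r := 0) _ _ _ _ (by simp)]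
  rfl

theorem IsDigitSeq.eq_digits {n : ℕ} (hn : 1 ≤ n) {x : ℤ → Fin (n + 1)} {δ : ℕ → Fin 3}
    (h : IsDigitSeq (tau n) x δ) : δ = digits x := by
  obtain ⟨y, h0, -, hs⟩ := h
  have hy : ∀ i, y i = desubst^[i] x := by
    intro i
    induction i with
    | zero => exact h0
    | succ i ih =>
      rw [Function.iterate_succ_apply', ← ih, hs i, desubst_shift_onSeq hn]
  funext i
  rw [digits, ← hy, hs i, firstDigit_shift_onSeq hn]

/-- Pigeonhole on the residue modulo 3 of the position at which long windows of `x` occur: one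
residue serves all lengths. -/
theorem exists_desubst {n : ℕ} {x : ℤ → Fin (n + 1)} (hx : x ∈ substShift (tau n)) :
    ∃ d : Fin 3, ∃ y ∈ substShift (tau n), x = shift^[(d : ℕ)] (onSeq (tau n) y) := by
  rw [mem_substShift_iff] at hx
  obtain ⟨d, hd⟩ : ∃ d : Fin 3, ∀ l : ℕ, ∃ (k : ℕ) (a : Fin (n + 1)) (Q : ℤ),
      MatchesAt x l (onWord (tau n) ((onWord (tau n))^[k] [a])) (3 * Q + d) := by
    by_contra! hcon
    choose l hl using hcon
    -- Longer than each failing length; the extra `1` excludes `k = 0`, where the word is a single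
    -- letter.
    obtain ⟨k, a, P, hP⟩ := hx (l 0 + l 1 + l 2 + 1)
    obtain ⟨Q, d, rfl⟩ := exists_eq_three_mul_add P
    cases k with
    | zero =>
      have h1 := hP 1 (by rw [abs_le]; omega)
      have h0 := hP (-1) (by rw [abs_le]; omega)
      obtain ⟨hlt, -⟩ := List.getElem?_eq_some_iff.1 h1.2
      simp at hlt
      omega
    | succ k =>
      rw [Function.iterate_succ_apply'] at hP
      refine hl d k a Q (hP.mono ?_)
      fin_cases d <;> simp <;> omega
  have hread : ∀ l : ℕ, ∃ (k : ℕ) (a : Fin (n + 1)) (Q : ℤ), ∀ (q : ℤ) (r : Fin 3),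
      |3 * q + r - d| ≤ l → 0 ≤ Q + q ∧ ∃ b, ((onWord (tau n))^[k] [a])[(Q + q).toNat]? = some b ∧
        x (3 * q + r - d) = tau n b r := by
    intro l
    obtain ⟨k, a, Q, hQ⟩ := hd l
    refine ⟨k, a, Q, fun q r hqr => ?_⟩
    obtain ⟨h1, h2⟩ := hQ _ hqr
    have h0 : 0 ≤ Q + q := by omega
    refine ⟨h0, ?_⟩
    rw [show (3 * Q + (d : ℤ) + (3 * q + r - d)).toNat = 3 * (Q + q).toNat + r by omega,
      getElem?_onWord, Option.map_eq_some_iff] at h2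
    obtain ⟨b, hb, e⟩ := h2
    exact ⟨b, hb, e.symm⟩
  refine ⟨d, fun q => x (3 * q - d), ?_, ?_⟩
  · rw [mem_substShift_iff]
    intro l
    obtain ⟨k, a, Q, hQ⟩ := hread (3 * l + 3)
    refine ⟨k, a, Q, fun q hq => ?_⟩
    obtain ⟨h0, b, hb, e⟩ := hQ q 0 (by rw [abs_le] at *; push_cast; simp; omega)
    refine ⟨h0, ?_⟩
    rw [hb, ← tau_zero n b, ← e]
    simp
  · funext i
    obtain ⟨q, r, hqr⟩ := exists_eq_three_mul_add (i + d)
    rw [shift_onSeq_apply _ _ _ _ q r hqr]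
    -- One window covers both position `i` and the start of its block, so both are read from the
    -- same letter `b`.
    obtain ⟨k, a, Q, hQ⟩ := hread (i.natAbs + 6)
    obtain ⟨-, b, hb, e⟩ := hQ q r (by rw [abs_le]; omega)
    obtain ⟨-, b', hb', e'⟩ := hQ q 0 (by rw [abs_le]; simp only [Fin.val_zero]; omega)
    rw [hb] at hb'
    obtain rfl : b = b' := by simpa using hb'
    rw [show 3 * q + (r : ℤ) - d = i by omega] at e
    simp only [Fin.val_zero, Nat.cast_zero, add_zero, tau_zero] at e'
    rw [e, e']

theorem desubst_mem {n : ℕ} (hn : 1 ≤ n) {x : ℤ → Fin (n + 1)} (hx : x ∈ substShift (tau n)) :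
    desubst x ∈ substShift (tau n) := by
  obtain ⟨d, y, hy, rfl⟩ := exists_desubst hx
  rwa [desubst_shift_onSeq hn]

theorem shift_onSeq_desubst {n : ℕ} (hn : 1 ≤ n) {x : ℤ → Fin (n + 1)}
    (hx : x ∈ substShift (tau n)) :
    shift^[(firstDigit x : ℕ)] (onSeq (tau n) (desubst x)) = x := by
  obtain ⟨d, y, hy, rfl⟩ := exists_desubst hx
  rw [desubst_shift_onSeq hn, firstDigit_shift_onSeq hn]

theorem desubst_iterate_mem {n : ℕ} (hn : 1 ≤ n) {x : ℤ → Fin (n + 1)}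
    (hx : x ∈ substShift (tau n)) (i : ℕ) : desubst^[i] x ∈ substShift (tau n) := by
  induction i with
  | zero => exact hx
  | succ i ih =>
    rw [Function.iterate_succ_apply']
    exact desubst_mem hn ih

theorem isDigitSeq_digits {n : ℕ} (hn : 1 ≤ n) {x : ℤ → Fin (n + 1)}
    (hx : x ∈ substShift (tau n)) : IsDigitSeq (tau n) x (digits x) := by
  refine ⟨fun i => desubst^[i] x, rfl, desubst_iterate_mem hn hx, fun i => ?_⟩
  simp only [Function.iterate_succ_apply', digits]
  exact (shift_onSeq_desubst hn (desubst_iterate_mem hn hx i)).symm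

/-! ### The fixed point of `τ_n` -/

/-- The two-sided sequence `x` with `x = T (τ_n(x))`, whose letter at the origin is `0`. -/
def fixedSeq (n : ℕ) (j : ℤ) : Fin (n + 1) :=
  if j = 0 then 0 else tau n (fixedSeq n ((j + 1) / 3)) ⟨((j + 1) % 3).toNat, by omega⟩
termination_by j.natAbs
decreasing_by omega

theorem fixedSeq_eq (n : ℕ) (j : ℤ) :
    fixedSeq n j = tau n (fixedSeq n ((j + 1) / 3)) ⟨((j + 1) % 3).toNat, by omega⟩ := by
  rw [fixedSeq]
  split_ifs with h
  · subst h
    rfl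
  · rfl

theorem fixedSeq_of_eq (n : ℕ) {j q : ℤ} {r : Fin 3} (h : j + 1 = 3 * q + r) :
    fixedSeq n j = tau n (fixedSeq n q) r := by
  obtain rfl : q = (j + 1) / 3 := by omega
  rw [fixedSeq_eq n j]
  congr 1
  exact Fin.ext (by simp only; omega)

theorem fixedSeq_zero (n : ℕ) : fixedSeq n 0 = 0 := by
  rw [fixedSeq, if_pos rfl]

theorem rho_fixedSeq (n : ℕ) (j : ℤ) : rho n (fixedSeq (n + 1) j) = fixedSeq n j := by
  by_cases h : j = 0
  · subst h
    rw [fixedSeq_zero, fixedSeq_zero]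
    rfl
  · rw [fixedSeq_eq, rho_tau, rho_fixedSeq n ((j + 1) / 3), ← fixedSeq_eq]
termination_by j.natAbs
decreasing_by omega

/-- The words `τ_n^k(0)`, placed with their middle at the origin, exhaust the sequence. -/
theorem fixedSeq_mem (n : ℕ) : fixedSeq n ∈ substShift (tau n) := by
  rw [mem_substShift_iff]
  have key : ∀ k : ℕ, ∃ c : ℕ, k ≤ c ∧
      MatchesAt (fixedSeq n) c ((onWord (tau n))^[k] [0]) c := by
    intro k
    induction k with
    | zero =>
      refine ⟨0, le_rfl, fun j hj => ?_⟩
      obtain rfl : j = 0 := by simpa using hj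
      rw [fixedSeq]
      simp
    | succ k ih =>
      obtain ⟨c, hc, hm⟩ := ih
      -- The centre `c` of a word moves to the middle of its image block.
      refine ⟨3 * c + 1, by omega, fun j hj => ?_⟩
      rw [abs_le] at hj
      refine ⟨by omega, ?_⟩
      obtain ⟨q, r, hqr⟩ := exists_eq_three_mul_add (j + 1)
      obtain ⟨h0, h1⟩ := hm q (by rw [abs_le]; omega)
      rw [show (((3 * c + 1 : ℕ) : ℤ) + j).toNat = 3 * ((c : ℤ) + q).toNat + r by omega,
        Function.iterate_succ_apply', getElem?_onWord, h1, fixedSeq_of_eq n hqr]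
      rfl
  intro l
  obtain ⟨c, hc, hm⟩ := key l
  exact ⟨l, 0, c, hm.mono hc⟩

/-! ### Sums of digits in the `3`-adic integers -/

/-- The `3`-adic integer with the given digits. -/
noncomputable def digitSum (δ : ℕ → Fin 3) : ℤ_[3] := ∑' i : ℕ, ((δ i : ℕ) : ℤ_[3]) * 3 ^ i

theorem norm_natCast_mul_three_pow_le (a i : ℕ) :
    ‖(a : ℤ_[3]) * 3 ^ i‖ ≤ (1 / 3 : ℝ) ^ i := by
  have h3 : ‖(3 : ℤ_[3])‖ = 1 / 3 := by simpa using PadicInt.norm_p (p := 3)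
  rw [norm_mul, norm_pow, h3]
  exact mul_le_of_le_one_left (by positivity) (PadicInt.norm_le_one _)

theorem summable_one_third_pow : Summable fun i : ℕ => (1 / 3 : ℝ) ^ i :=
  summable_geometric_of_lt_one (by norm_num) (by norm_num)

theorem summable_digits (δ : ℕ → Fin 3) :
    Summable fun i : ℕ => ((δ i : ℕ) : ℤ_[3]) * 3 ^ i :=
  summable_one_third_pow.of_norm_bounded fun i => norm_natCast_mul_three_pow_le _ i

theorem digitSum_eq (δ : ℕ → Fin 3) :
    digitSum δ = (δ 0 : ℕ) + 3 * digitSum fun i => δ (i + 1) := by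
  rw [digitSum, (summable_digits δ).tsum_eq_zero_add, digitSum, ← (summable_digits _).tsum_mul_left]
  simp only [pow_zero, mul_one, pow_succ]
  congr 1
  refine tsum_congr fun i => ?_
  ring

/-- Reduction modulo 3 isolates the first digit; then `3` is cancelled. -/
theorem digitSum_head_tail {δ ε : ℕ → Fin 3} (h : digitSum δ = digitSum ε) :
    δ 0 = ε 0 ∧ (digitSum fun i => δ (i + 1)) = digitSum fun i => ε (i + 1) := by
  have h1 := h
  rw [digitSum_eq δ, digitSum_eq ε] at h1
  have h0 : δ 0 = ε 0 := by
    have hd : ((((δ 0 : ℕ) : ℤ) - ((ε 0 : ℕ) : ℤ) : ℤ) : ℤ_[3]) =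
        3 * ((digitSum fun i => ε (i + 1)) - digitSum fun i => δ (i + 1)) := by
      push_cast
      linear_combination h1
    have hlt : ‖((((δ 0 : ℕ) : ℤ) - ((ε 0 : ℕ) : ℤ) : ℤ) : ℤ_[3])‖ < 1 := by
      have h3 : ‖(3 : ℤ_[3])‖ = 1 / 3 := by simpa using PadicInt.norm_p (p := 3)
      rw [hd, norm_mul, h3]
      have := PadicInt.norm_le_one ((digitSum fun i => ε (i + 1)) - digitSum fun i => δ (i + 1))
      linarith
    rw [PadicInt.norm_int_lt_one_iff_dvd] at hlt
    apply Fin.ext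
    push_cast at hlt
    omega
  refine ⟨h0, ?_⟩
  rw [h0] at h1
  exact mul_left_cancel₀ (OfNat.ofNat_ne_zero 3) (add_left_cancel h1)

theorem digitSum_injective : Function.Injective digitSum := by
  have key : ∀ (i : ℕ) (δ ε : ℕ → Fin 3), digitSum δ = digitSum ε → δ i = ε i := by
    intro i
    induction i with
    | zero => exact fun δ ε h => (digitSum_head_tail h).1
    | succ i ih => exact fun δ ε h => ih _ _ (digitSum_head_tail h).2
  exact fun δ ε h => funext fun i => key i δ ε h

theorem digitSum_zero : digitSum 0 = 0 := by simp [digitSum]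

theorem digitSum_two : (digitSum fun _ => 2) = -1 := by
  have h := digitSum_eq fun _ => 2
  simp only [Fin.val_two, Nat.cast_ofNat] at h
  refine mul_left_cancel₀ (two_ne_zero (α := ℤ_[3])) ?_
  linear_combination -h

theorem exists_intCast_of_tail {c : Fin 3} (hc : ∃ m : ℤ, (digitSum fun _ => c) = m) (K : ℕ)
    (δ : ℕ → Fin 3) (hδ : ∀ k, K ≤ k → δ k = c) : ∃ m : ℤ, digitSum δ = m := by
  induction K generalizing δ with
  | zero =>
    obtain rfl : δ = fun _ => c := funext fun k => hδ k (Nat.zero_le k)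
    exact hc
  | succ K ih =>
    obtain ⟨m, hm⟩ := ih (fun i => δ (i + 1)) fun k hk => hδ _ (by omega)
    refine ⟨(δ 0 : ℕ) + 3 * m, ?_⟩
    rw [digitSum_eq, hm]
    push_cast
    ring

theorem frequently_ne_zero_and_two {δ : ℕ → Fin 3} (h : ∀ m : ℤ, digitSum δ ≠ m) (k : ℕ) :
    (∃ m, k ≤ m ∧ δ m ≠ 0) ∧ ∃ m, k ≤ m ∧ δ m ≠ 2 := by
  constructor
  · by_contra! hcon
    obtain ⟨m, hm⟩ := exists_intCast_of_tail ⟨0, digitSum_zero.trans Int.cast_zero.symm⟩ k δ hcon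
    exact h m hm
  · by_contra! hcon
    obtain ⟨m, hm⟩ := exists_intCast_of_tail ⟨-1, by simpa using digitSum_two⟩ k δ hcon
    exact h m hm

/-! ### The odometer value of a point of `X_n` -/

theorem firstDigit_shift_of_ne_two {n : ℕ} (hn : 1 ≤ n) {x : ℤ → Fin (n + 1)}
    (hx : x ∈ substShift (tau n)) (h : firstDigit x ≠ 2) :
    (firstDigit (shift x) : ℕ) = firstDigit x + 1 ∧ desubst (shift x) = desubst x := by
  have hlt : (firstDigit x : ℕ) + 1 < 3 := by
    have : (firstDigit x : ℕ) ≠ 2 := fun e => h (Fin.ext e)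
    omega
  have e : shift x = shift^[((⟨firstDigit x + 1, hlt⟩ : Fin 3) : ℕ)] (onSeq (tau n) (desubst x)) := by
    conv_lhs => rw [← shift_onSeq_desubst hn hx]
    rw [← Function.iterate_succ_apply' shift]
  rw [e, firstDigit_shift_onSeq hn, desubst_shift_onSeq hn]
  exact ⟨rfl, rfl⟩

theorem firstDigit_shift_of_eq_two {n : ℕ} (hn : 1 ≤ n) {x : ℤ → Fin (n + 1)}
    (hx : x ∈ substShift (tau n)) (h : firstDigit x = 2) :
    firstDigit (shift x) = 0 ∧ desubst (shift x) = shift (desubst x) := by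
  have e : shift x = shift^[((0 : Fin 3) : ℕ)] (onSeq (tau n) (shift (desubst x))) := by
    funext i
    obtain ⟨q, r, rfl⟩ := exists_eq_three_mul_add i
    rw [shift_onSeq_apply _ _ _ _ q r (by simp)]
    conv_lhs => rw [← shift_onSeq_desubst hn hx, h]
    rw [shift, shift_onSeq_apply _ _ _ _ (q + 1) r (by simp; ring)]
    rfl
  rw [e, firstDigit_shift_onSeq hn, desubst_shift_onSeq hn]
  exact ⟨rfl, rfl⟩

theorem digitSum_digits_eq {n : ℕ} (x : ℤ → Fin (n + 1)) :
    digitSum (digits x) = (firstDigit x : ℕ) + 3 * digitSum (digits (desubst x)) :=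
  digitSum_eq _

/-- A first digit `2` becomes `0` and the shift is carried to `desubst x`. Carrying may never stop,
but each carry multiplies the error by `1/3`. -/
theorem digitSum_digits_shift {n : ℕ} (hn : 1 ≤ n) {x : ℤ → Fin (n + 1)}
    (hx : x ∈ substShift (tau n)) :
    digitSum (digits (shift x)) = digitSum (digits x) + 1 := by
  have key : ∀ (k : ℕ) (x : ℤ → Fin (n + 1)), x ∈ substShift (tau n) →
      ‖digitSum (digits (shift x)) - (digitSum (digits x) + 1)‖ ≤ (1 / 3 : ℝ) ^ k := by
    intro k
    induction k with
    | zero =>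
      intro x _
      simpa using PadicInt.norm_le_one _
    | succ k ih =>
      intro x hx
      by_cases h : firstDigit x = 2
      · obtain ⟨h1, h2⟩ := firstDigit_shift_of_eq_two hn hx h
        rw [digitSum_digits_eq, digitSum_digits_eq x, h1, h2, h]
        have h3 : ‖(3 : ℤ_[3])‖ = 1 / 3 := by simpa using PadicInt.norm_p (p := 3)
        have e : ∀ a b : ℤ_[3], (((0 : Fin 3) : ℕ) : ℤ_[3]) + 3 * a -
            ((((2 : Fin 3) : ℕ) : ℤ_[3]) + 3 * b + 1) = 3 * (a - (b + 1)) := by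
          intro a b
          simp only [Fin.val_zero, Fin.val_two]
          push_cast
          ring
        rw [e, norm_mul, h3, pow_succ']
        exact mul_le_mul_of_nonneg_left (ih _ (desubst_mem hn hx)) (by norm_num)
      · obtain ⟨h1, h2⟩ := firstDigit_shift_of_ne_two hn hx h
        rw [digitSum_digits_eq, digitSum_digits_eq x, h1, h2]
        push_cast
        ring_nf
        simp
  have hlim : Tendsto (fun k : ℕ => (1 / 3 : ℝ) ^ k) atTop (𝓝 0) :=
    tendsto_pow_atTop_nhds_zero_of_lt_one (by norm_num) (by norm_num)
  have := ge_of_tendsto' hlim fun k => key k x hx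
  rwa [norm_le_zero_iff, sub_eq_zero] at this

theorem continuous_firstDigit {n : ℕ} :
    Continuous (firstDigit : (ℤ → Fin (n + 1)) → Fin 3) := by
  have h : Continuous fun x : ℤ → Fin (n + 1) => (x 0, x 1, x 2) := by fun_prop
  exact (continuous_of_discreteTopology (f := fun u : Fin (n + 1) × Fin (n + 1) × Fin (n + 1) =>
    if u.2.1 = 0 ∧ u.2.2 ≠ 0 then (0 : Fin 3) else if u.1 = 0 ∧ u.2.1 ≠ 0 then 1 else 2)).comp h

theorem continuous_desubst {n : ℕ} :
    Continuous (desubst : (ℤ → Fin (n + 1)) → ℤ → Fin (n + 1)) := by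
  refine continuous_pi fun q => ?_
  have h : Continuous fun x : ℤ → Fin (n + 1) => (firstDigit x, fun d : Fin 3 => x (3 * q - (d : ℕ))) :=
    continuous_firstDigit.prodMk (by fun_prop)
  exact (continuous_of_discreteTopology
    (f := fun u : Fin 3 × (Fin 3 → Fin (n + 1)) => u.2 u.1)).comp h

theorem continuous_digitSum_digits {n : ℕ} :
    Continuous fun x : ℤ → Fin (n + 1) => digitSum (digits x) := by
  refine continuous_tsum (fun i => ?_) summable_one_third_pow
    fun i x => norm_natCast_mul_three_pow_le _ i
  refine Continuous.mul ?_ continuous_const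
  exact (continuous_of_discreteTopology (f := fun d : Fin 3 => ((d : ℕ) : ℤ_[3]))).comp
    (continuous_firstDigit.comp (continuous_desubst.iterate i))

/-! ### Towers of desubstitutions -/

/-- `y` is a tower of desubstitutions with digits `δ`: `y_k = T^{δ_k} (τ (y_{k+1}))`. -/
def IsTower {A : Type*} (τ : A → Fin 3 → A) (δ : ℕ → Fin 3) (y : ℕ → ℤ → A) : Prop :=
  ∀ (k : ℕ) (j q : ℤ) (r : Fin 3), j + (δ k : ℕ) = 3 * q + (r : ℕ) → y k j = τ (y (k + 1) q) r

theorem isTower_desubst {n : ℕ} (hn : 1 ≤ n) {x : ℤ → Fin (n + 1)}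
    (hx : x ∈ substShift (tau n)) : IsTower (tau n) (digits x) fun k => desubst^[k] x := by
  intro k j q r h
  have := shift_onSeq_desubst hn (desubst_iterate_mem hn hx k)
  simp only [Function.iterate_succ_apply']
  conv_lhs => rw [← this]
  exact shift_onSeq_apply _ _ _ _ _ _ h

/-- For `|j| ≥ 2` the block containing `j` has an index of smaller absolute value one level up. -/
theorem IsTower.eq_of_eq_near_zero {A : Type*} {τ : A → Fin 3 → A} {δ : ℕ → Fin 3}
    {y y' : ℕ → ℤ → A} (h : IsTower τ δ y) (h' : IsTower τ δ y') (hm : ∀ k, y k (-1) = y' k (-1))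
    (h0 : ∀ k, y k 0 = y' k 0) (h1 : ∀ k, y k 1 = y' k 1) : y = y' := by
  have key : ∀ (N : ℕ) (j : ℤ), j.natAbs ≤ N → ∀ k, y k j = y' k j := by
    intro N
    induction N with
    | zero =>
      intro j hj k
      obtain rfl : j = 0 := by omega
      exact h0 k
    | succ N ih =>
      intro j hj k
      by_cases hj1 : j.natAbs ≤ 1
      · obtain rfl | rfl | rfl : j = -1 ∨ j = 0 ∨ j = 1 := by omega
        · exact hm k
        · exact h0 k
        · exact h1 k
      · obtain ⟨q, r, hqr⟩ := exists_eq_three_mul_add (j + (δ k : ℕ))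
        rw [h k j q r hqr, h' k j q r hqr, ih q (by omega)]
  exact funext fun k => funext fun j => key _ j le_rfl k

/-- A condition which holds at arbitrarily high levels and is inherited downwards holds
everywhere. -/
theorem forall_of_frequently_of_succ {P Q : ℕ → Prop} (hP : ∀ k, ∃ m, k ≤ m ∧ P m)
    (hPQ : ∀ m, P m → Q m) (hQ : ∀ m, Q (m + 1) → Q m) (k : ℕ) : Q k := by
  obtain ⟨m, hkm, hm⟩ := hP k
  have := hPQ m hm
  clear hm
  induction m, hkm using Nat.le_induction with
  | base => exact this
  | succ m _ ih => exact ih (hQ m this)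

/-- A digit `1` forces the letter `0`, which fixes all lower levels. If `1` eventually stops
occurring, infinitely many digits `2` each raise the letter, with only `0`s between, so it is
saturated at `n` on all high levels. -/
theorem letters_unique {n : ℕ} {ε : ℕ → Fin 3} {a a' : ℕ → Fin (n + 1)}
    (ha : ∀ k, a k = tau n (a (k + 1)) (ε k)) (ha' : ∀ k, a' k = tau n (a' (k + 1)) (ε k))
    (hε : ∀ k, ∃ m, k ≤ m ∧ ε m ≠ 0) (k : ℕ) : a k = a' k := by
  by_cases hone : ∀ k, ∃ m, k ≤ m ∧ ε m = 1
  · refine forall_of_frequently_of_succ hone (Q := fun k => a k = a' k) (fun m hm => ?_)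
      (fun m hm => ?_) k
    · rw [ha, ha', hm, tau_one, tau_one]
    · rw [ha, ha', hm]
  · push Not at hone
    obtain ⟨K, hK⟩ := hone
    -- Induction on the bound `c`: a digit `2` raises it by one, and descending through digits `0`
    -- or `2` does not lower it.
    have htop : ∀ b : ℕ → Fin (n + 1), (∀ k, b k = tau n (b (k + 1)) (ε k)) →
        ∀ c ≤ n, ∀ m, c ≤ (b (K + m) : ℕ) := by
      intro b hb c
      induction c with
      | zero => intros; omega
      | succ c ih =>
        intro hc
        have ih := ih (by omega)
        refine forall_of_frequently_of_succ (P := fun m => ε (K + m) ≠ 0) (fun m => ?_)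
          (fun m hm => ?_) (fun m hm => ?_)
        · obtain ⟨m', h1, h2⟩ := hε (K + m)
          exact ⟨m' - K, by omega, by rwa [show K + (m' - K) = m' by omega]⟩
        · have h2 : ε (K + m) = 2 :=
            (by decide : ∀ e : Fin 3, e ≠ 0 → e ≠ 1 → e = 2) _ hm (hK (K + m) (by omega))
          rw [hb, h2, val_tau_two]
          have := ih (m + 1)
          rw [← add_assoc] at this
          omega
        · rw [← add_assoc] at hm
          have := hK (K + m) (by omega)
          rw [hb]
          generalize ε (K + m) = e at *
          fin_cases e
          · exact hm
          · simp at this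
          · have := val_tau_two n (b (K + m + 1))
            simp only [Fin.reduceFinMk] at this ⊢
            omega
    refine forall_of_frequently_of_succ (P := fun m => K ≤ m) (Q := fun k => a k = a' k)
      (fun k => ⟨max k K, le_max_left _ _, le_max_right _ _⟩) (fun m hm => ?_) (fun m hm => ?_) k
    · obtain ⟨d, rfl⟩ := Nat.exists_eq_add_of_le hm
      have h1 := htop a ha n le_rfl d
      have h2 := htop a' ha' n le_rfl d
      apply Fin.ext
      omega
    · rw [ha, ha', hm]

theorem IsTower.eq_of_frequently {n : ℕ} {δ : ℕ → Fin 3} {y y' : ℕ → ℤ → Fin (n + 1)}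
    (h : IsTower (tau n) δ y) (h' : IsTower (tau n) δ y') (hδ0 : ∀ k, ∃ m, k ≤ m ∧ δ m ≠ 0)
    (hδ2 : ∀ k, ∃ m, k ≤ m ∧ δ m ≠ 2) : y = y' := by
  have h0 : ∀ k, y k 0 = y' k 0 :=
    letters_unique (fun k => h k 0 0 (δ k) (by simp)) (fun k => h' k 0 0 (δ k) (by simp)) hδ0
  refine h.eq_of_eq_near_zero h' ?_ h0 ?_
  -- Unless the digit is `0`, position `-1` lies in the block of the origin, whose letter is known.
  -- For digit `0` it ends block `-1` and depends on the same position one level up. Position `1` is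
  -- symmetric, with digit `2`.
  · have hP : ∀ m, δ m ≠ 0 → y m (-1) = y' m (-1) := by
      intro m hm
      have hpos : 1 ≤ (δ m : ℕ) := Nat.one_le_iff_ne_zero.2 fun e => hm (Fin.ext e)
      have e : (-1 : ℤ) + (δ m : ℕ) = 3 * 0 + ((⟨δ m - 1, by omega⟩ : Fin 3) : ℕ) := by
        simp only
        omega
      rw [h _ _ _ _ e, h' _ _ _ _ e, h0]
    refine forall_of_frequently_of_succ hδ0 hP fun m hm => ?_
    by_cases hd : δ m = 0
    · rw [h m (-1) (-1) 2 (by simp [hd]), h' m (-1) (-1) 2 (by simp [hd]), hm]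
    · exact hP m hd
  · have hP : ∀ m, δ m ≠ 2 → y m 1 = y' m 1 := by
      intro m hm
      have hlt : (δ m : ℕ) ≠ 2 := fun e => hm (Fin.ext e)
      have e : (1 : ℤ) + (δ m : ℕ) = 3 * 0 + ((⟨δ m + 1, by omega⟩ : Fin 3) : ℕ) := by
        simp only
        omega
      rw [h _ _ _ _ e, h' _ _ _ _ e, h0]
    refine forall_of_frequently_of_succ hδ2 hP fun m hm => ?_
    by_cases hd : δ m = 2
    · rw [h m 1 1 0 (by simp [hd]), h' m 1 1 0 (by simp [hd]), hm]
    · exact hP m hd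

/-- The letter at `0` is the same on all levels, the one at `1` is a middle letter, and the one at
`-1` is always a last letter, so `letters_unique` applies with constant digit `2`. -/
theorem IsTower.eq_of_digits_zero {n : ℕ} {y y' : ℕ → ℤ → Fin (n + 1)}
    (h : IsTower (tau n) 0 y) (h' : IsTower (tau n) 0 y') (h00 : y 0 0 = y' 0 0) : y = y' := by
  have h0 : ∀ k, y k 0 = y' k 0 := by
    intro k
    induction k with
    | zero => exact h00
    | succ k ih =>
      rw [h k 0 0 0 (by simp), h' k 0 0 0 (by simp)] at ih
      exact ih
  refine h.eq_of_eq_near_zero h' ?_ h0 fun k => ?_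
  · exact letters_unique (ε := fun _ => 2) (fun k => h k (-1) (-1) 2 (by simp))
      (fun k => h' k (-1) (-1) 2 (by simp)) fun k => ⟨k, le_rfl, by simp⟩
  · rw [h k 1 0 1 (by simp), h' k 1 0 1 (by simp), tau_one, tau_one]

/-! ### The inverse limit -/

theorem digits_rho {n : ℕ} (hn : 1 ≤ n) {x : ℤ → Fin (n + 1 + 1)}
    (hx : x ∈ substShift (tau (n + 1))) : digits (fun i => rho n (x i)) = digits x :=
  (((isDigitSeq_digits (by omega) hx).comp (rho_tau n)).eq_digits hn).symm

theorem digits_invLimit (x : invLimit) (k : ℕ) : digits (x.1 k) = digits (x.1 0) := by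
  induction k with
  | zero => rfl
  | succ k ih => rw [← ih, ← x.2.2 k, digits_rho (by omega) (x.2.1 (k + 1))]

/-- The factor map from the inverse limit to the `3`-odometer. -/
noncomputable def toOdometer (x : invLimit) : ℤ_[3] := digitSum (digits (x.1 0))

theorem continuous_toOdometer : Continuous toOdometer :=
  continuous_digitSum_digits.comp ((continuous_apply 0).comp continuous_subtype_val)

theorem toOdometer_invShift (x : invLimit) : toOdometer (invShift x) = toOdometer x + 1 :=
  digitSum_digits_shift le_rfl (x.2.1 0)

theorem toOdometer_iterate (x : invLimit) (k : ℕ) :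
    toOdometer (invShift^[k] x) = toOdometer x + k := by
  induction k with
  | zero => simp
  | succ k ih =>
    rw [Function.iterate_succ_apply', toOdometer_invShift, ih]
    push_cast
    ring

instance : CompactSpace invLimit := by
  rw [← isCompact_iff_compactSpace]
  refine IsClosed.isCompact ?_
  have : invLimit = (⋂ k, {x | x k ∈ substShift (tau (k + 1))}) ∩
      ⋂ k, {x | (fun i => rho (k + 1) (x (k + 1) i)) = x k} := by
    ext x
    simp [invLimit]
  rw [this]
  refine (isClosed_iInter fun k => ?_).inter (isClosed_iInter fun k => ?_)
  · exact (isClosed_substShift _).preimage (continuous_apply k)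
  · refine isClosed_eq (continuous_pi fun i => ?_) (continuous_apply k)
    exact (continuous_of_discreteTopology (f := rho (k + 1))).comp
      ((continuous_apply i).comp (continuous_apply (k + 1)))

instance : Nonempty invLimit :=
  ⟨⟨fun k => fixedSeq (k + 1), fun k => fixedSeq_mem (k + 1),
    fun k => funext fun i => rho_fixedSeq (k + 1) i⟩⟩

/-- The image is compact and contains a translate of `ℕ`, which is dense. -/
theorem toOdometer_surjective : Function.Surjective toOdometer := by
  obtain ⟨x⟩ := (inferInstance : Nonempty invLimit)
  have hd : DenseRange fun k : ℕ => toOdometer x + (k : ℤ_[3]) :=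
    (Homeomorph.addLeft (toOdometer x)).surjective.denseRange.comp PadicInt.denseRange_natCast
      (Homeomorph.addLeft (toOdometer x)).continuous
  have hd' : DenseRange toOdometer := by
    refine hd.mono ?_
    rintro _ ⟨k, rfl⟩
    exact ⟨_, toOdometer_iterate x k⟩
  rw [← Set.range_eq_univ, ← hd'.closure_range,
    (isCompact_range continuous_toOdometer).isClosed.closure_eq]

theorem invShift_injective : Function.Injective invShift := by
  intro x x' h
  apply Subtype.ext
  funext k i
  have := congrFun (congrFun (congrArg Subtype.val h) k) (i - 1)
  simpa [invShift, shift] using this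

theorem invShift_surjective : Function.Surjective invShift := by
  intro x
  refine ⟨⟨fun k i => x.1 k (i - 1), fun k => unshift_mem_substShift (x.2.1 k), fun k => ?_⟩, ?_⟩
  · funext i
    exact congrFun (x.2.2 k) (i - 1)
  · apply Subtype.ext
    funext k i
    simp [invShift, shift]

/-! ### Fibres of the factor map -/

theorem countable_compatible_letters :
    {b : ∀ k : ℕ, Fin (k + 1 + 1) | ∀ k, rho (k + 1) (b (k + 1)) = b k}.Countable := by
  have hmin : ∀ b : ∀ k : ℕ, Fin (k + 1 + 1), (∀ k, rho (k + 1) (b (k + 1)) = b k) →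
      ∀ k m, k ≤ m → (b k : ℕ) = min (b m : ℕ) (k + 1) := by
    intro b hb k m hkm
    induction m, hkm using Nat.le_induction with
    | base =>
      have := (b k).isLt
      omega
    | succ m hkm ih =>
      rw [ih, ← hb m, val_rho]
      omega
  -- A compatible sequence is the truncation of its supremum `s` in `ℕ∞`: `b k = min s (k + 1)`.
  refine Set.MapsTo.countable_of_injOn (f := fun b => ⨆ k, ((b k : ℕ) : ℕ∞))
    (Set.mapsTo_univ _ _) ?_ Set.countable_univ
  have hval : ∀ b : ∀ k : ℕ, Fin (k + 1 + 1), (∀ k, rho (k + 1) (b (k + 1)) = b k) →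
      ∀ k, ((b k : ℕ) : ℕ∞) = min (⨆ m, ((b m : ℕ) : ℕ∞)) ((k + 1 : ℕ) : ℕ∞) := by
    intro b hb k
    apply le_antisymm
    · refine le_min (le_iSup (fun m => ((b m : ℕ) : ℕ∞)) k) ?_
      exact_mod_cast Nat.lt_succ_iff.1 (b k).isLt
    · rw [iSup_inf_eq]
      refine iSup_le fun m => ?_
      rw [← (Nat.mono_cast (α := ℕ∞)).map_min]
      norm_cast
      rcases le_total k m with h | h
      · exact (hmin b hb k m h).ge
      · have := hmin b hb m k h
        omega
  intro b hb b' hb' h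
  funext k
  apply Fin.ext
  have := hval b hb k
  simp only at h
  rw [h, ← hval b' hb' k] at this
  exact_mod_cast this

theorem invLimit_ext_of_letters {x x' : invLimit} (hx : toOdometer x = 0) (hx' : toOdometer x' = 0)
    (h : ∀ k, x.1 k 0 = x'.1 k 0) : x = x' := by
  have hd : ∀ {x : invLimit}, toOdometer x = 0 → ∀ k, digits (x.1 k) = 0 := by
    intro x hx k
    rw [digits_invLimit]
    exact digitSum_injective (hx.trans digitSum_zero.symm)
  apply Subtype.ext
  funext k
  have t := isTower_desubst (Nat.le_add_left 1 k) (x.2.1 k)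
  have t' := isTower_desubst (Nat.le_add_left 1 k) (x'.2.1 k)
  rw [hd hx] at t
  rw [hd hx'] at t'
  exact congrFun (t.eq_of_digits_zero t' (h k)) 0

theorem countable_fiber_zero : (toOdometer ⁻¹' {0}).Countable := by
  refine Set.MapsTo.countable_of_injOn (f := fun (x : invLimit) (k : ℕ) => x.1 k 0)
    (t := {b : ∀ k : ℕ, Fin (k + 1 + 1) | ∀ k, rho (k + 1) (b (k + 1)) = b k})
    (fun x _ k => congrFun (x.2.2 k) 0) ?_ countable_compatible_letters
  intro x hx x' hx' h
  exact invLimit_ext_of_letters hx hx' (congrFun h)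

theorem countable_fiber_add_one {z : ℤ_[3]} :
    (toOdometer ⁻¹' {z + 1}).Countable ↔ (toOdometer ⁻¹' {z}).Countable := by
  have e : toOdometer ⁻¹' {z} = invShift ⁻¹' (toOdometer ⁻¹' {z + 1}) := by
    ext x
    simp [toOdometer_invShift]
  constructor
  · intro h
    rw [e]
    exact h.preimage invShift_injective
  · intro h
    rw [e] at h
    rw [← Set.image_preimage_eq (toOdometer ⁻¹' {z + 1}) invShift_surjective]
    exact h.image _

theorem countable_fiber_intCast (m : ℤ) : (toOdometer ⁻¹' {(m : ℤ_[3])}).Countable := by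
  induction m using Int.induction_on with
  | zero => simpa using countable_fiber_zero
  | succ m ih =>
    push_cast at ih ⊢
    exact countable_fiber_add_one.2 ih
  | pred m ih =>
    rw [← countable_fiber_add_one]
    push_cast at ih ⊢
    simpa using ih

theorem subsingleton_fiber {z : ℤ_[3]} (hz : ∀ m : ℤ, z ≠ m) :
    (toOdometer ⁻¹' {z}).Subsingleton := by
  intro x hx x' hx'
  have hd : digits (x'.1 0) = digits (x.1 0) := digitSum_injective (Eq.trans hx' (Eq.symm hx))
  have hfr := frequently_ne_zero_and_two (δ := digits (x.1 0)) fun m e =>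
    hz m (Eq.trans (Eq.symm hx) e)
  apply Subtype.ext
  funext k
  have t := isTower_desubst (Nat.le_add_left 1 k) (x.2.1 k)
  have t' := isTower_desubst (Nat.le_add_left 1 k) (x'.2.1 k)
  rw [digits_invLimit] at t
  rw [digits_invLimit, hd] at t'
  exact congrFun (t.eq_of_frequently t' (fun i => (hfr i).1) fun i => (hfr i).2) 0

theorem countable_fiber (z : ℤ_[3]) : (toOdometer ⁻¹' {z}).Countable := by
  by_cases hz : ∃ m : ℤ, z = m
  · obtain ⟨m, rfl⟩ := hz
    exact countable_fiber_intCast m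
  · push Not at hz
    exact (subsingleton_fiber hz).countable

/-! ### Scrambled sets -/

/-- On a compact space, a continuous map onto an isometric system identifies the points of a
Li-Yorke pair. -/
theorem IsLiYorkePair.map_eq {X Y : Type*} [t : TopologicalSpace X] [CompactSpace X]
    [MetricSpace Y] {m : MetricSpace X} (hm : IsCompatible m t) {T : X → X} {f : X → Y}
    (hf : Continuous f) {x y : X} (hT : ∀ k, dist (f (T^[k] x)) (f (T^[k] y)) = dist (f x) (f y))
    (h : IsLiYorkePair m T x y) : f x = f y := by
  unfold IsCompatible at hm
  subst hm
  by_contra hne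
  -- Uniform continuity turns arbitrarily close iterates into arbitrarily close images, whose
  -- distance is constant.
  have hu := CompactSpace.uniformContinuous_of_continuous hf
  rw [EMetric.uniformContinuous_iff] at hu
  obtain ⟨δ, hδ, H⟩ := hu (edist (f x) (f y)) (edist_pos.2 hne)
  have hlt : liminf (fun n : ℕ => edist (T^[n] x) (T^[n] y)) atTop < δ := by
    rw [h.2]
    exact hδ
  obtain ⟨k, hk⟩ := (frequently_lt_of_liminf_lt (by isBoundedDefault) hlt).exists
  have := H hk
  rw [edist_dist, edist_dist, hT] at this
  exact lt_irrefl _ this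

theorem IsScrambled.countable {m : MetricSpace invLimit} (hm : IsCompatible m inferInstance)
    {S : Set invLimit} (hS : IsScrambled m invShift S) : S.Countable := by
  rcases S.eq_empty_or_nonempty with rfl | ⟨x, hx⟩
  · exact Set.countable_empty
  · refine (countable_fiber (toOdometer x)).mono fun y hy => ?_
    by_cases hxy : y = x
    · rw [hxy]
      rfl
    · refine (hS hy hx hxy).map_eq hm continuous_toOdometer fun k => ?_
      rw [toOdometer_iterate, toOdometer_iterate, dist_add_right]

end SubstInvLim

open SubstInvLim in
/-- The `3`-odometer is the ring `ℤ_[3]` of `3`-adic integers (the inverse limit of the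
`ℤ / 3^k ℤ`) with the addition of `1`. The first part and the clause on digit sequences say that
`π` is the map which sends `x = (x_n)` to the `3`-adic integer whose digits are those of
any `x_n`. -/
theorem proposition4p3 :
    (∀ n : ℕ, 1 ≤ n → ∀ x ∈ substShift (tau n), ∃! δ : ℕ → Fin 3, IsDigitSeq (tau n) x δ) ∧
    ∃ π : invLimit → ℤ_[3],
      (∀ (x : invLimit) (k : ℕ) (δ : ℕ → Fin 3), IsDigitSeq (tau (k + 1)) (x.1 k) δ →
        HasSum (fun i : ℕ => ((δ i : ℕ) : ℤ_[3]) * 3 ^ i) (π x)) ∧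
      Continuous π ∧ Function.Surjective π ∧ (∀ x, π (invShift x) = π x + 1) ∧
      (∀ z : ℤ_[3], (π ⁻¹' {z}).Countable) ∧
      ∀ m : MetricSpace invLimit, IsCompatible m inferInstance →
        ∀ S : Set invLimit, IsScrambled m invShift S → S.Countable := by
  refine ⟨fun n hn x hx => ⟨digits x, isDigitSeq_digits hn hx, fun δ hδ => hδ.eq_digits hn⟩,
    toOdometer, fun x k δ hδ => ?_, continuous_toOdometer, toOdometer_surjective,
    toOdometer_invShift, countable_fiber, fun m hm S hS => IsScrambled.countable hm hS⟩
  obtain rfl := hδ.eq_digits (Nat.le_add_left 1 k)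
  rw [digits_invLimit]
  exact (summable_digits _).hasSum
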